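/- **Setting.** An online MDP has a finite state space $S$, a finite non-empty action set $A$, a fixed transition model $P(x'\mid x,a)$, an initial state distribution $\mu_0$, and $L$ loss vectors $\boldsymbol l_1,\dots,\boldsymbol l_L\in[0,1]^{S\times A}$; let $\Delta_L$ be the set of their convex combinations. In round $t$ the agent uses a policy $\pi_t(\cdot\mid s)$, and the adversary chooses $\boldsymbol l_t\in\Delta_L$ as an arbitrary fixed function of $\pi_1,\dots,\pi_{t-1}$; write $\boldsymbol l_t^{\pi_t}$ for the losses generated against $\pi_1,\pi_2,\dots$, and $\boldsymbol l_t^{\pi}$ for those generated when the agent always plays a fixed policy $\pi$. The policy regret with respect to $\pi$ is $$R_T(\pi)=\mathbb E\Big[\sum_{t=1}^T \boldsymbol l_t^{\pi_t}(X_t,A_t)\Big]-\mathbb E\Big[\sum_{t=1}^T \boldsymbol l_t^{\pi}(X_t^{\pi},A_t^{\pi})\Big],$$ where $X_1\sim\mu_0$, $A_t\sim\pi_t(\cdot\mid X_t)$, $X_{t+1}\sim P(\cdot\mid X_t,A_t)$, and likewise with $\pi$ in place of every $\pi_t$ for $(X_t^\pi,A_t^\pi)$. **Assumptions.** (Mixing,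 with parameter $\tau>0$.) With $P(\pi)_{s,s'}=\sum_a\pi(a\mid s)P(s'\mid s,a)$, every policy $\pi$ and all distributions $d,d'$ on $S$ satisfy $\|dP(\pi)-d'P(\pi)\|_1\le e^{-1/\tau}\|d-d'\|_1$. Hence $\pi$ has a unique stationary state distribution; let $\boldsymbol d_\pi(s,a)$ be its mass at $s$ times $\pi(a\mid s)$. (Strategic adversary, at horizon $T$.) For every sequence of policies $\pi_1,\pi_2,\dots$ of the agent, $$\max_{\boldsymbol l\in\Delta_L}\Big(\sum_{t=1}^T\langle \boldsymbol l,\boldsymbol d_{\pi_t}\rangle-\sum_{t=1}^T\langle \boldsymbol l_t^{\pi_t},\boldsymbol d_{\pi_t}\rangle\Big)\le\sqrt{\tfrac{T\log L}{2}} .$$ **Algorithm (MDP-Expert).** For a policy $\pi$ and a loss $\boldsymbol l$ let $Q_{\pi,\boldsymbol l}(s,a)=\sum_{t\ge1}\big(\mathbb E[\boldsymbol l(s_t,a_t)\mid s_1=s,a_1=a,\pi]-\langle \boldsymbol l,\boldsymbol d_\pi\rangle\big)$. The agent starts with the uniform policy $\pi_1(a\mid s)=1/|A|$ and, in every state $s$,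 runs Multiplicative Weights Update on the feedback $Q_{\pi_t,\boldsymbol l_t}(s,\cdot)$: $$\pi_{t+1}(a\mid s)=\frac{\pi_t(a\mid s)\,e^{-\mu Q_{\pi_t,\boldsymbol l_t}(s,a)}}{\sum_{b}\pi_t(b\mid s)\,e^{-\mu Q_{\pi_t,\boldsymbol l_t}(s,b)}},\qquad \mu=\frac1{3\tau}\sqrt{\frac{8\log|A|}{T}} .$$ **Theorem.** For every $\tau_0>0$ there is a constant $C$, depending on $\tau_0$ only (so an absolute constant for $\tau\ge1$), such that the following holds for all online MDPs, all $L$, all $\tau\ge\tau_0$, all $T\ge1$, and all adversaries as above. If the mixing assumption holds with parameter $\tau$, the adversary is strategic at horizon $T$, and the agent runs MDP-Expert with the above $\mu$, then for every fixed policy $\pi$ $$R_T(\pi)\le C\big(\sqrt{T\log L}+\tau^2\sqrt{T\log|A|}\big).$$ -/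

import Mathlib

/-!
Online Markov decision processes with a non-oblivious adversary.
Rounds are numbered from `0` in the code: index `t` stands for round `t + 1`.
-/

noncomputable section

namespace OMDP

/-- An online MDP with finite state space `S`, finite action set `A`, transition model
`P(x' | x, a)`, initial state distribution, and the `L` loss vectors of the adversary, which
have entries in `[0, 1]`. -/
structure Model (S A : Type*) [Fintype S] [Fintype A] (L : ℕ) where
  trans : S → A → stdSimplex ℝ S
  init : stdSimplex ℝ S
  loss : Fin L → S → A → ℝ
  loss_mem : ∀ i s a, loss i s a ∈ Set.Icc (0 : ℝ) 1

/-- A (stationary, randomized) policy: `π s a` is the probability `π(a | s)`. -/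
abbrev Policy (S A : Type*) [Fintype A] := S → stdSimplex ℝ A

variable {S A : Type*} [Fintype S] [Fintype A] {L : ℕ}

/-- The set `Δ_L` of all mixtures of the `L` loss vectors. -/
def Model.lossSimplex (M : Model S A L) : Set (S → A → ℝ) :=
  {l | ∃ x ∈ stdSimplex ℝ (Fin L), ∀ s a, l s a = ∑ i, x i * M.loss i s a}

/-- A (non-oblivious) adversary: in every round it chooses an element of `Δ_L` as a function of the
policies that the agent has used in the earlier rounds. -/
abbrev Adversary (M : Model S A L) := (t : ℕ) → (Fin t → Policy S A) → M.lossSimplex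

/-- The loss function chosen in round `t` when the agent uses the policies `p 0, p 1, …`. -/
def Adversary.lossAt {M : Model S A L} (adv : Adversary M) (p : ℕ → Policy S A) (t : ℕ) :
    S → A → ℝ :=
  (adv t fun i => p i : M.lossSimplex)

/-- The state transition matrix `P(π)` acting on (row) vectors: `d ↦ d P(π)`. -/
def Model.push (M : Model S A L) (π : Policy S A) (d : S → ℝ) : S → ℝ :=
  fun s' => ∑ s, d s * ∑ a, π s a * M.trans s a s'

/-- The mixing time assumption with parameter `τ` (in the `ℓ₁` norm). -/
def Model.Mixing (M : Model S A L) (τ : ℝ) : Prop :=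
  ∀ (π : Policy S A) (d d' : stdSimplex ℝ S),
    ∑ s, |M.push π d s - M.push π d' s| ≤ Real.exp (-1 / τ) * ∑ s, |d s - d' s|

/-- `d` is a stationary state distribution of the policy `π`. -/
def Model.IsStationary (M : Model S A L) (π : Policy S A) (d : stdSimplex ℝ S) : Prop :=
  M.push π d = d

/-- The stationary state distribution of `π`
(unique under the mixing assumption, see `Model.Mixing.existsUnique_isStationary`). -/
def Model.stationary (M : Model S A L) (π : Policy S A) : stdSimplex ℝ S :=
  @Classical.epsilon _ ⟨M.init⟩ fun d => M.IsStationary π d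

/-- The average loss `η_l(π) = ⟨l, d_π⟩`, where `d_π(s, a)` is the stationary probability of `s`
times `π(a | s)`. -/
def Model.avgLoss (M : Model S A L) (l : S → A → ℝ) (π : Policy S A) : ℝ :=
  ∑ s, ∑ a, l s a * (M.stationary π s * π s a)

/-- The probability of the path `(x₁, a₁), …, (x_T, a_T)` when the first state-action pair has
distribution `ν` and the agent uses policy `p t` in round `t` afterwards. -/
def Model.pathProb (M : Model S A L) (ν : S → A → ℝ) (p : ℕ → Policy S A) :
    (T : ℕ) → (Fin T → S × A) → ℝ
  | 0, _ => 1
  | 1, ω => ν (ω 0).1 (ω 0).2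
  | n + 2, ω =>
      let x := ω (Fin.last n).castSucc
      let y := ω (Fin.last (n + 1))
      M.pathProb ν p (n + 1) (Fin.init ω) * (M.trans x.1 x.2 y.1 * p (n + 1) y.1 y.2)

/-- The expectation of a function of the first `T` state-action pairs. -/
def Model.expect (M : Model S A L) (ν : S → A → ℝ) (p : ℕ → Policy S A) (T : ℕ)
    (f : (Fin T → S × A) → ℝ) : ℝ :=
  ∑ ω, M.pathProb ν p T ω * f ω

/-- The accumulated loss
`Q_{π,l}(s,a) = E[∑_{t ≥ 1} (l(s_t, a_t) - η_l(π)) | s₁ = s, a₁ = a, π]`,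
i.e. the sum over the rounds of the expected loss in excess of `η_l(π)`. -/
def Model.Q (M : Model S A L) (π : Policy S A) (l : S → A → ℝ) (s : S) (a : A) : ℝ :=
  ∑' n : ℕ, M.expect (fun x b => Set.indicator {(s, a)} (fun _ => (1 : ℝ)) (x, b)) (fun _ => π)
    (n + 1) fun ω => l (ω (Fin.last n)).1 (ω (Fin.last n)).2 - M.avgLoss l π

/-- One step of multiplicative weights with learning rate `μ` and feedback `k`. -/
def mwuStep (μ : ℝ) (w : stdSimplex ℝ A) (k : A → ℝ) : stdSimplex ℝ A :=
  ⟨fun a => w a * Real.exp (-μ * k a) / ∑ b, w b * Real.exp (-μ * k b), by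
    have h0 : ∀ b, 0 ≤ w b * Real.exp (-μ * k b) :=
      fun b => mul_nonneg (stdSimplex.zero_le w b) (Real.exp_pos _).le
    have hpos : 0 < ∑ b, w b * Real.exp (-μ * k b) := by
      refine lt_of_le_of_ne (Finset.sum_nonneg fun b _ => h0 b) fun h => ?_
      have hz := (Finset.sum_eq_zero_iff_of_nonneg fun b _ => h0 b).1 h.symm
      have h1 : ∑ b, w b = 0 := Finset.sum_eq_zero fun b hb =>
        (mul_eq_zero.1 (hz b hb)).resolve_right (Real.exp_pos _).ne'
      rw [stdSimplex.sum_eq_one] at h1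
      exact one_ne_zero h1
    refine ⟨fun a => div_nonneg (h0 a) hpos.le, ?_⟩
    rw [← Finset.sum_div, div_self hpos.ne']⟩

/-- The uniform distribution on the actions. -/
def uniform [Nonempty A] : stdSimplex ℝ A :=
  ⟨fun _ => 1 / (Fintype.card A : ℝ), fun _ => by positivity, by simp⟩

/-- MDP-Expert against the adversary `adv`: starting from the uniform policy, in every state `s`
the agent runs multiplicative weights (learning rate `μ t` in round `t`) with the
feedback `Q_{π_t, l_t}(s, ·)`, where `l_t` is the adversary's reply to the agent's earlier
policies. -/
def mdpExpert [Nonempty A] {M : Model S A L} (adv : Adversary M) (μ : ℕ → ℝ) :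
    ℕ → Policy S A
  | 0 => fun _ => uniform
  | t + 1 => fun s =>
      mwuStep (μ t) (mdpExpert adv μ t s)
        (M.Q (mdpExpert adv μ t) (adv t fun i : Fin t => mdpExpert adv μ i : M.lossSimplex) s)
termination_by t => t
decreasing_by all_goals omega

/-- The expected cumulative loss of the agent over `T` rounds, `E[∑_{t ≤ T} l_t(X_t, A_t)]`, when
it uses the policies `p 0, p 1, …` and the adversary adapts to them. -/
def Adversary.cumLoss {M : Model S A L} (adv : Adversary M) (p : ℕ → Policy S A) (T : ℕ) : ℝ :=
  M.expect (fun s a => M.init s * p 0 s a) p T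
    fun ω => ∑ t : Fin T, adv.lossAt p t (ω t).1 (ω t).2

/-- The policy regret of the agent that uses `p 0, p 1, …` with respect to the fixed policy `π`:
the adversary is allowed to adapt to `π` in the comparison term. -/
def Adversary.policyRegret {M : Model S A L} (adv : Adversary M) (p : ℕ → Policy S A)
    (π : Policy S A) (T : ℕ) : ℝ :=
  adv.cumLoss p T - adv.cumLoss (fun _ => π) T

/-- The adversary has no external regret, at the optimal rate: whatever policies the
agent uses, the regret over `T` rounds with respect to the stationary distributions
is at most `√(T log L / 2)`. -/
def Adversary.Strategic {M : Model S A L} (adv : Adversary M) (T : ℕ) : Prop :=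
  ∀ p : ℕ → Policy S A, ∀ l ∈ M.lossSimplex,
    ∑ t ∈ Finset.range T, M.avgLoss l (p t) -
      ∑ t ∈ Finset.range T, M.avgLoss (adv.lossAt p t) (p t) ≤ √(T * Real.log L / 2)

theorem Model.push_mem (M : Model S A L) (π : Policy S A) (d : stdSimplex ℝ S) :
    M.push π d ∈ stdSimplex ℝ S := by
  refine ⟨fun s' => Finset.sum_nonneg fun s _ => mul_nonneg (stdSimplex.zero_le d s)
    (Finset.sum_nonneg fun a _ => mul_nonneg (stdSimplex.zero_le _ a)
      (stdSimplex.zero_le _ s')), ?_⟩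
  have h : ∀ s, ∑ s', ∑ a, π s a * M.trans s a s' = 1 := fun s => by
    rw [Finset.sum_comm]
    simp [← Finset.mul_sum, stdSimplex.sum_eq_one]
  unfold Model.push
  rw [Finset.sum_comm]
  simp [← Finset.mul_sum, h, stdSimplex.sum_eq_one]

/-- Under the mixing assumption every policy has exactly one stationary state distribution. -/
theorem Model.Mixing.existsUnique_isStationary {M : Model S A L} {τ : ℝ} (hτ : 0 < τ)
    (hM : M.Mixing τ) (π : Policy S A) : ∃! d, M.IsStationary π d := by
  have hc : Real.exp (-1 / τ) < 1 := by
    rw [Real.exp_lt_one_iff]; exact div_neg_of_neg_of_pos (by norm_num) hτ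
  have hcont : Continuous fun d : stdSimplex ℝ S => ∑ s, |M.push π d s - d s| := by
    have : ∀ s, Continuous fun d : stdSimplex ℝ S => d s := fun s =>
      (continuous_apply s).comp continuous_subtype_val
    unfold Model.push
    exact continuous_finsetSum _ fun s _ => ((continuous_finsetSum _ fun s' _ =>
      (this s').mul continuous_const).sub (this s)).abs
  have aux : ∀ d : stdSimplex ℝ S, ∀ e : S → ℝ, ∑ s, |e s - d s| ≤ 0 → e = d := by
    intro d e h
    have h' := (Finset.sum_eq_zero_iff_of_nonneg fun s _ => abs_nonneg (e s - d s)).1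
      (le_antisymm h (Finset.sum_nonneg fun s _ => abs_nonneg _))
    funext s
    exact sub_eq_zero.1 (abs_eq_zero.1 (h' s (Finset.mem_univ s)))
  obtain ⟨d, -, hd⟩ := isCompact_univ.exists_isMinOn ⟨M.init, Set.mem_univ _⟩ hcont.continuousOn
  have hst : M.IsStationary π d := by
    apply aux
    have h1 := hd (Set.mem_univ (⟨M.push π d, M.push_mem π d⟩ : stdSimplex ℝ S))
    have h2 := hM π ⟨M.push π d, M.push_mem π d⟩ d
    have h3 := (show _ ≤ _ from h1).trans h2
    change ∑ s, |M.push π d s - d s| ≤ _ * ∑ s, |M.push π d s - d s| at h3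
    nlinarith
  refine ⟨d, hst, fun e he => stdSimplex.ext (aux d e ?_)⟩
  have h := hM π e d
  rw [show M.push π e = e from he, show M.push π d = d from hst] at h
  nlinarith

end OMDP

end

/-! Policy regret splits into four differences, obtained by inserting the stationary losses
`avgLoss` of the learner and of the comparator `π`. Write `K = (1 - exp (-1/τ))⁻¹`, which is of
order `τ`.

Learner versus its stationary losses: each multiplicative weights step moves the policy by at most
`δ = 16μK` in `ℓ₁`, so the true state law tracks the drifting stationary law, at total cost `2K +
TδK²` (`sum_l1dist_stateLaw_le`). This is the source of the `τ²`.

Stationary losses of the learner versus those of `π`, on the same loss sequence: the performance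
difference identity (`avgLoss_sub_avgLoss`) writes this as an average of per-state regrets with
feedback `Q`, weighted by the stationary law of `π`. The weights do not depend on the round, so the
regret bound `mwu_regret_le` applies state by state.

Losses generated against the learner versus losses generated against `π`, both evaluated at `π`:
here the adversary's own no-regret property is used, with the agent playing `π` throughout
(`Strategic.sum_avgLoss_sub_le`).

Stationary versus true loss of `π`: a fixed policy does not drift, so mixing alone costs `2K`. -/

noncomputable section

namespace OMDP

variable {S A : Type*} [Fintype S] [Fintype A] {L : ℕ}

/-! ### Path expectations in terms of one-round marginals -/

/-- The joint law of the state-action pair of round `n`. -/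
def Model.pairLaw (M : Model S A L) (ν : S → A → ℝ) (p : ℕ → Policy S A) : ℕ → S → A → ℝ
  | 0 => ν
  | n + 1 => fun y b => (∑ s, ∑ a, M.pairLaw ν p n s a * M.trans s a y) * p (n + 1) y b

/-- The state distribution after one step of the policy `π` from the state distribution `d`. -/
def Model.step (M : Model S A L) (π : Policy S A) (d : stdSimplex ℝ S) : stdSimplex ℝ S :=
  ⟨M.push π d, M.push_mem π d⟩

/-- The law of the state of round `n` when the initial state distribution is `d`. -/
def Model.stateLaw (M : Model S A L) (d : stdSimplex ℝ S) (p : ℕ → Policy S A) :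
    ℕ → stdSimplex ℝ S
  | 0 => d
  | n + 1 => M.step (p n) (M.stateLaw d p n)

theorem Model.expect_succ_succ (M : Model S A L) (ν : S → A → ℝ) (p : ℕ → Policy S A) (n : ℕ)
    (f : (Fin (n + 2) → S × A) → ℝ) :
    M.expect ν p (n + 2) f = M.expect ν p (n + 1) fun ω => ∑ s, ∑ a,
      M.trans (ω (Fin.last n)).1 (ω (Fin.last n)).2 s * p (n + 1) s a *
        f (Fin.snoc (α := fun _ => S × A) ω (s, a)) := by
  unfold Model.expect
  rw [← (Fin.snocEquiv fun _ : Fin (n + 2) => S × A).sum_comp, Fintype.sum_prod_type_right]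
  refine Finset.sum_congr rfl fun ω _ => ?_
  rw [Fintype.sum_prod_type, Finset.mul_sum]
  refine Finset.sum_congr rfl fun s _ => ?_
  rw [Finset.mul_sum]
  refine Finset.sum_congr rfl fun a _ => ?_
  simp only [Fin.snocEquiv, Equiv.coe_fn_mk, Model.pathProb, Fin.snoc_castSucc, Fin.snoc_last,
    Fin.init_snoc]
  ring

theorem Model.sum_trans_mul (M : Model S A L) (π : Policy S A) (x : S) (b : A) :
    ∑ s, ∑ a, M.trans x b s * π s a = 1 := by
  simp [← Finset.mul_sum, stdSimplex.sum_eq_one]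

theorem Model.expect_init (M : Model S A L) (ν : S → A → ℝ) (p : ℕ → Policy S A) (n : ℕ)
    (g : (Fin (n + 1) → S × A) → ℝ) :
    M.expect ν p (n + 2) (fun ω => g fun i => ω i.castSucc) = M.expect ν p (n + 1) g := by
  rw [M.expect_succ_succ]
  congr 1
  funext ω
  simp only [Fin.snoc_castSucc, ← Finset.sum_mul, M.sum_trans_mul, one_mul]

theorem Model.expect_one (M : Model S A L) (ν : S → A → ℝ) (p : ℕ → Policy S A)
    (f : (Fin 1 → S × A) → ℝ) :
    M.expect ν p 1 f = ∑ s, ∑ a, ν s a * f fun _ => (s, a) := by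
  unfold Model.expect
  rw [← (Equiv.funUnique (Fin 1) (S × A)).symm.sum_comp, Fintype.sum_prod_type]
  rfl

theorem Model.expect_last (M : Model S A L) (ν : S → A → ℝ) (p : ℕ → Policy S A) (n : ℕ)
    (f : S → A → ℝ) :
    M.expect ν p (n + 1) (fun ω => f (ω (Fin.last n)).1 (ω (Fin.last n)).2) =
      ∑ s, ∑ a, M.pairLaw ν p n s a * f s a := by
  induction n generalizing f with
  | zero => rw [M.expect_one]; rfl
  | succ n ih =>
    rw [M.expect_succ_succ]
    simp only [Fin.snoc_last]
    rw [ih fun x b => ∑ s, ∑ a, M.trans x b s * p (n + 1) s a * f s a]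
    simp only [Model.pairLaw, Finset.mul_sum, Finset.sum_mul]
    simp_rw [Finset.sum_comm (s := (Finset.univ : Finset A)) (t := (Finset.univ : Finset S))]
    rw [Finset.sum_comm]
    refine Finset.sum_congr rfl fun y _ => ?_
    rw [Finset.sum_comm]
    simp_rw [Finset.sum_comm (s := (Finset.univ : Finset S)) (t := (Finset.univ : Finset A))]
    rw [Finset.sum_comm]
    refine Finset.sum_congr rfl fun _ _ => Finset.sum_congr rfl fun _ _ =>
      Finset.sum_congr rfl fun _ _ => by ring

theorem Model.expect_add (M : Model S A L) (ν : S → A → ℝ) (p : ℕ → Policy S A) (n : ℕ)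
    (f g : (Fin n → S × A) → ℝ) :
    M.expect ν p n (fun ω => f ω + g ω) = M.expect ν p n f + M.expect ν p n g := by
  simp [Model.expect, mul_add, Finset.sum_add_distrib]

theorem Model.expect_sum (M : Model S A L) (ν : S → A → ℝ) (p : ℕ → Policy S A) (n : ℕ)
    (f : ℕ → S → A → ℝ) :
    M.expect ν p n (fun ω => ∑ t : Fin n, f t (ω t).1 (ω t).2) =
      ∑ t ∈ Finset.range n, ∑ s, ∑ a, M.pairLaw ν p t s a * f t s a := by
  induction n with
  | zero => simp [Model.expect]
  | succ n ih =>
    rw [Finset.sum_range_succ, ← ih, ← M.expect_last]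
    cases n with
    | zero => simp [Model.expect]
    | succ n =>
      simp_rw [Fin.sum_univ_castSucc (n := n + 1)]
      -- The summands before the last do not see the final round, which `expect_init` integrates
      -- out.
      rw [M.expect_add]
      congr 1
      exact M.expect_init ν p n fun ω => ∑ t : Fin (n + 1), f t (ω t).1 (ω t).2

theorem Model.pairLaw_prod (M : Model S A L) (d : stdSimplex ℝ S) (p : ℕ → Policy S A) (n : ℕ)
    (s : S) (a : A) :
    M.pairLaw (fun s a => d s * p 0 s a) p n s a = M.stateLaw d p n s * p n s a := by
  induction n generalizing s a with
  | zero => rfl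
  | succ n ih =>
    simp only [Model.pairLaw, ih]
    congr 1
    change _ = ∑ x, _
    simp only [Finset.mul_sum, mul_assoc]

theorem Adversary.cumLoss_eq {M : Model S A L} (adv : Adversary M) (p : ℕ → Policy S A) (T : ℕ) :
    adv.cumLoss p T = ∑ t ∈ Finset.range T, ∑ s, ∑ a,
      adv.lossAt p t s a * (M.stateLaw M.init p t s * p t s a) := by
  unfold Adversary.cumLoss
  rw [M.expect_sum]
  simp only [M.pairLaw_prod]
  simp only [mul_comm]

/-- A fixed first pair is not of the form state law times policy, so `pairLaw_prod` does not apply.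
From the next round on the product form returns, with starting law `M.trans x b` and the policies
shifted by one. -/
theorem Model.pairLaw_indicator (M : Model S A L) (x : S) (b : A) (p : ℕ → Policy S A) (n : ℕ)
    (s : S) (a : A) :
    M.pairLaw (fun y c => Set.indicator {(x, b)} (fun _ => (1 : ℝ)) (y, c)) p (n + 1) s a =
      M.stateLaw (M.trans x b) (fun k => p (k + 1)) n s * p (n + 1) s a := by
  classical
  induction n generalizing s a with
  | zero =>
    simp only [Model.pairLaw, Model.stateLaw]
    congr 1
    rw [← Fintype.sum_prod_type'
      (f := fun s_1 a => ({(x, b)} : Set (S × A)).indicator (fun _ => (1 : ℝ)) (s_1, a) *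
        M.trans s_1 a s)]
    simp [Set.indicator_apply]
  | succ n ih =>
    rw [Model.pairLaw]
    simp only [ih]
    congr 1
    change _ = ∑ x, _
    simp only [Finset.mul_sum, mul_assoc]

/-! ### The `ℓ₁` distance on the simplex -/

/-- The `ℓ₁` distance of two distributions. -/
def l1dist {X : Type*} [Fintype X] (d e : stdSimplex ℝ X) : ℝ := ∑ x, |d x - e x|

theorem l1dist_nonneg {X : Type*} [Fintype X] (d e : stdSimplex ℝ X) : 0 ≤ l1dist d e :=
  Finset.sum_nonneg fun _ _ => abs_nonneg _

theorem l1dist_triangle {X : Type*} [Fintype X] (d e f : stdSimplex ℝ X) :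
    l1dist d f ≤ l1dist d e + l1dist e f := by
  unfold l1dist
  rw [← Finset.sum_add_distrib]
  exact Finset.sum_le_sum fun x _ => abs_sub_le _ _ _

theorem l1dist_le_two {X : Type*} [Fintype X] (d e : stdSimplex ℝ X) : l1dist d e ≤ 2 := by
  calc l1dist d e ≤ ∑ x, (d x + e x) := Finset.sum_le_sum fun x _ => by
        have h1 := stdSimplex.zero_le d x
        have h2 := stdSimplex.zero_le e x
        rw [abs_le]; constructor <;> linarith
    _ = 2 := by
        rw [Finset.sum_add_distrib, stdSimplex.sum_eq_one, stdSimplex.sum_eq_one]; norm_num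

theorem abs_sum_sub_sum_le_l1dist {X : Type*} [Fintype X] (d e : stdSimplex ℝ X) {f : X → ℝ}
    {B : ℝ} (hf : ∀ x, |f x| ≤ B) :
    |∑ x, d x * f x - ∑ x, e x * f x| ≤ B * l1dist d e := by
  rw [← Finset.sum_sub_distrib, l1dist, Finset.mul_sum]
  refine (Finset.abs_sum_le_sum_abs _ _).trans (Finset.sum_le_sum fun x _ => ?_)
  rw [← sub_mul, abs_mul, mul_comm]
  exact mul_le_mul_of_nonneg_right (hf x) (abs_nonneg _)

theorem abs_sum_mul_le {X : Type*} [Fintype X] (d : stdSimplex ℝ X) {f : X → ℝ} {B : ℝ}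
    (hf : ∀ x, |f x| ≤ B) : |∑ x, d x * f x| ≤ B := by
  refine (Finset.abs_sum_le_sum_abs _ _).trans ?_
  calc ∑ x, |d x * f x| ≤ ∑ x, d x * B := Finset.sum_le_sum fun x _ => by
        rw [abs_mul, abs_of_nonneg (stdSimplex.zero_le d x)]
        exact mul_le_mul_of_nonneg_left (hf x) (stdSimplex.zero_le d x)
    _ = B := by rw [← Finset.sum_mul, stdSimplex.sum_eq_one, one_mul]

/-! ### Excess losses, the Poisson equation and the Bellman form of `Q` -/

/-- The conditional expectation of `f` after one step of the policy `π`, given the state. -/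
def Model.backup (M : Model S A L) (π : Policy S A) (f : S → ℝ) : S → ℝ :=
  fun s => ∑ a, π s a * ∑ s', M.trans s a s' * f s'

/-- The expected loss of the policy `π` in every state. -/
def policyLoss (π : Policy S A) (l : S → A → ℝ) : S → ℝ := fun s => ∑ a, π s a * l s a

theorem Model.sum_step_mul (M : Model S A L) (π : Policy S A) (d : stdSimplex ℝ S) (f : S → ℝ) :
    ∑ s, M.step π d s * f s = ∑ s, d s * M.backup π f s := by
  change ∑ s', (∑ s, d s * ∑ a, π s a * M.trans s a s') * f s' = _
  simp only [Model.backup, Finset.mul_sum, Finset.sum_mul]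
  rw [Finset.sum_comm]
  refine Finset.sum_congr rfl fun s _ => ?_
  rw [Finset.sum_comm]
  exact Finset.sum_congr rfl fun _ _ => Finset.sum_congr rfl fun _ _ => by ring

/-- `backup` is the adjoint of `step`, so the evolution can be moved from distributions to
functions, where pointwise statements about each starting state make sense. -/
theorem Model.sum_stateLaw_mul (M : Model S A L) (π : Policy S A) (d : stdSimplex ℝ S)
    (n : ℕ) (f : S → ℝ) :
    ∑ s, M.stateLaw d (fun _ => π) n s * f s = ∑ s, d s * (M.backup π)^[n] f s := by
  induction n generalizing f with
  | zero => rfl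
  | succ n ih =>
    rw [Function.iterate_succ_apply, ← ih]
    exact M.sum_step_mul π _ f

theorem Model.Mixing.l1dist_step_le {M : Model S A L} {τ : ℝ} (hM : M.Mixing τ) (π : Policy S A)
    (d e : stdSimplex ℝ S) :
    l1dist (M.step π d) (M.step π e) ≤ Real.exp (-1 / τ) * l1dist d e := hM π d e

theorem Model.Mixing.step_stationary {M : Model S A L} {τ : ℝ} (hτ : 0 < τ) (hM : M.Mixing τ)
    (π : Policy S A) : M.step π (M.stationary π) = M.stationary π :=
  stdSimplex.ext (Classical.epsilon_spec (hM.existsUnique_isStationary hτ π).exists)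

theorem Model.avgLoss_eq (M : Model S A L) (l : S → A → ℝ) (π : Policy S A) :
    M.avgLoss l π = ∑ s, M.stationary π s * policyLoss π l s := by
  simp only [Model.avgLoss, policyLoss, Finset.mul_sum]
  exact Finset.sum_congr rfl fun _ _ => Finset.sum_congr rfl fun _ _ => by ring

theorem abs_policyLoss_le {S A : Type*} [Fintype A] {l : S → A → ℝ} (hl : ∀ s a, |l s a| ≤ 1) (π : Policy S A) (s : S) :
    |policyLoss π l s| ≤ 1 := abs_sum_mul_le (π s) (hl s)

theorem Model.abs_avgLoss_le (M : Model S A L) {l : S → A → ℝ} (hl : ∀ s a, |l s a| ≤ 1)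
    (π : Policy S A) : |M.avgLoss l π| ≤ 1 := by
  rw [M.avgLoss_eq]
  exact abs_sum_mul_le _ (abs_policyLoss_le hl π)

theorem Model.Mixing.l1dist_stateLaw_stationary_le {M : Model S A L} {τ : ℝ} (hτ : 0 < τ)
    (hM : M.Mixing τ) (π : Policy S A) (d : stdSimplex ℝ S) (n : ℕ) :
    l1dist (M.stateLaw d (fun _ => π) n) (M.stationary π) ≤ 2 * Real.exp (-1 / τ) ^ n := by
  induction n with
  | zero => simpa using l1dist_le_two _ _
  | succ n ih =>
    have h := hM.l1dist_step_le π (M.stateLaw d (fun _ => π) n) (M.stationary π)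
    rw [hM.step_stationary hτ π] at h
    refine h.trans ((mul_le_mul_of_nonneg_left ih (Real.exp_pos _).le).trans (le_of_eq ?_))
    rw [pow_succ]; ring

/-- The expected excess of the loss of round `n` over the average loss, given the first state. -/
def Model.excess (M : Model S A L) (π : Policy S A) (l : S → A → ℝ) (n : ℕ) : S → ℝ :=
  fun s => (M.backup π)^[n] (policyLoss π l) s - M.avgLoss l π

theorem Model.sum_mul_excess (M : Model S A L) (π : Policy S A) (l : S → A → ℝ) (n : ℕ)
    (d : stdSimplex ℝ S) :
    ∑ s, d s * M.excess π l n s =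
      ∑ s, M.stateLaw d (fun _ => π) n s * policyLoss π l s - M.avgLoss l π := by
  simp only [Model.excess, mul_sub, Finset.sum_sub_distrib, M.sum_stateLaw_mul, ← Finset.sum_mul,
    stdSimplex.sum_eq_one, one_mul]

theorem Model.Mixing.abs_sum_mul_excess_le {M : Model S A L} {τ : ℝ} (hτ : 0 < τ)
    (hM : M.Mixing τ) (π : Policy S A) {l : S → A → ℝ} (hl : ∀ s a, |l s a| ≤ 1) (n : ℕ)
    (d : stdSimplex ℝ S) :
    |∑ s, d s * M.excess π l n s| ≤ 2 * Real.exp (-1 / τ) ^ n := by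
  rw [M.sum_mul_excess, M.avgLoss_eq]
  refine (abs_sum_sub_sum_le_l1dist _ _ (abs_policyLoss_le hl π)).trans ?_
  rw [one_mul]
  exact hM.l1dist_stateLaw_stationary_le hτ π d n

theorem sum_vertex_mul {X : Type*} [Fintype X] [DecidableEq X] (x : X) (f : X → ℝ) :
    ∑ y, (stdSimplex.vertex (S := ℝ) x) y * f y = f x := by
  simp [Pi.single_apply]

/-- Geometric mixing from a point mass. The resulting summability makes `bias` and `Q` genuine sums
instead of the default value of `tsum`. -/
theorem Model.Mixing.abs_excess_le {M : Model S A L} {τ : ℝ} (hτ : 0 < τ)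
    (hM : M.Mixing τ) (π : Policy S A) {l : S → A → ℝ} (hl : ∀ s a, |l s a| ≤ 1) (n : ℕ) (s : S) :
    |M.excess π l n s| ≤ 2 * Real.exp (-1 / τ) ^ n := by
  classical
  simpa only [sum_vertex_mul] using
    hM.abs_sum_mul_excess_le hτ π hl n (stdSimplex.vertex (S := ℝ) s)

theorem exp_neg_one_div_lt_one {τ : ℝ} (hτ : 0 < τ) : Real.exp (-1 / τ) < 1 := by
  rw [Real.exp_lt_one_iff]
  exact div_neg_of_neg_of_pos (by norm_num) hτ

theorem Model.Mixing.summable_excess {M : Model S A L} {τ : ℝ} (hτ : 0 < τ)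
    (hM : M.Mixing τ) (π : Policy S A) {l : S → A → ℝ} (hl : ∀ s a, |l s a| ≤ 1) (s : S) :
    Summable fun n => M.excess π l n s :=
  Summable.of_norm_bounded
    ((summable_geometric_of_lt_one (Real.exp_pos _).le (exp_neg_one_div_lt_one hτ)).mul_left 2)
    fun n => hM.abs_excess_le hτ π hl n s

/-- The bias function of `π` for the loss `l`: the total expected excess over the average loss. -/
def Model.bias (M : Model S A L) (π : Policy S A) (l : S → A → ℝ) : S → ℝ :=
  fun s => ∑' n, M.excess π l n s

theorem Model.Mixing.abs_bias_le {M : Model S A L} {τ : ℝ} (hτ : 0 < τ)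
    (hM : M.Mixing τ) (π : Policy S A) {l : S → A → ℝ} (hl : ∀ s a, |l s a| ≤ 1) (s : S) :
    |M.bias π l s| ≤ 2 * (1 - Real.exp (-1 / τ))⁻¹ := by
  rw [← Real.norm_eq_abs, Model.bias]
  exact tsum_of_norm_bounded
    ((hasSum_geometric_of_lt_one (Real.exp_pos _).le (exp_neg_one_div_lt_one hτ)).mul_left 2)
    fun n => hM.abs_excess_le hτ π hl n s

theorem Model.Q_term_zero (M : Model S A L) (π : Policy S A) (l : S → A → ℝ) (s : S) (a : A) :
    M.expect (fun x b => Set.indicator {(s, a)} (fun _ => (1 : ℝ)) (x, b)) (fun _ => π) 1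
      (fun ω => l (ω (Fin.last 0)).1 (ω (Fin.last 0)).2 - M.avgLoss l π) =
        l s a - M.avgLoss l π := by
  classical
  rw [M.expect_one, ← Fintype.sum_prod_type' (f := fun x b =>
    ({(s, a)} : Set (S × A)).indicator (fun _ => (1 : ℝ)) (x, b) * (l x b - M.avgLoss l π))]
  simp [Set.indicator_apply]

theorem Model.Q_term_succ (M : Model S A L) (π : Policy S A) (l : S → A → ℝ) (s : S) (a : A)
    (n : ℕ) :
    M.expect (fun x b => Set.indicator {(s, a)} (fun _ => (1 : ℝ)) (x, b)) (fun _ => π) (n + 2)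
      (fun ω => l (ω (Fin.last (n + 1))).1 (ω (Fin.last (n + 1))).2 - M.avgLoss l π) =
        ∑ s', M.trans s a s' * M.excess π l n s' := by
  rw [M.expect_last _ _ _ fun x b => l x b - M.avgLoss l π, M.sum_mul_excess]
  simp only [M.pairLaw_indicator, mul_sub, Finset.sum_sub_distrib, ← Finset.sum_mul,
    mul_assoc, ← Finset.mul_sum, stdSimplex.sum_eq_one, one_mul, policyLoss]

theorem Model.Mixing.Q_eq {M : Model S A L} {τ : ℝ} (hτ : 0 < τ)
    (hM : M.Mixing τ) (π : Policy S A) {l : S → A → ℝ} (hl : ∀ s a, |l s a| ≤ 1) (s : S) (a : A) :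
    M.Q π l s a = l s a - M.avgLoss l π + ∑ s', M.trans s a s' * M.bias π l s' := by
  have hs : HasSum (fun n => ∑ s', M.trans s a s' * M.excess π l n s')
      (∑ s', M.trans s a s' * M.bias π l s') :=
    hasSum_sum fun s' _ => (hM.summable_excess hτ π hl s').hasSum.mul_left _
  unfold Model.Q
  rw [Summable.tsum_eq_zero_add, M.Q_term_zero]
  · congr 1
    rw [← hs.tsum_eq]
    exact tsum_congr fun n => M.Q_term_succ π l s a n
  · rw [← summable_nat_add_iff 1]
    exact hs.summable.congr fun n => (M.Q_term_succ π l s a n).symm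

theorem Model.Mixing.abs_Q_le {M : Model S A L} {τ : ℝ} (hτ : 0 < τ)
    (hM : M.Mixing τ) (π : Policy S A) {l : S → A → ℝ} (hl : ∀ s a, l s a ∈ Set.Icc (0 : ℝ) 1)
    (s : S) (a : A) :
    |M.Q π l s a| ≤ 4 * (1 - Real.exp (-1 / τ))⁻¹ := by
  have hl' : ∀ s a, |l s a| ≤ 1 := fun s a => abs_le.2 ⟨by linarith [(hl s a).1], (hl s a).2⟩
  rw [hM.Q_eq hτ π hl']
  have h1 := abs_sum_mul_le (M.trans s a) (hM.abs_bias_le hτ π hl')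
  have h2 := M.abs_avgLoss_le hl' π
  have h3 := hl' s a
  -- The loss and its average contribute at most `1` each and the bias `2K`; since `K ≥ 1`, the
  -- total is at most `4K`.
  have h4 : 1 ≤ (1 - Real.exp (-1 / τ))⁻¹ :=
    (one_le_inv₀ (by linarith [exp_neg_one_div_lt_one hτ])).2 (by linarith [Real.exp_pos (-1 / τ)])
  rw [abs_le] at *
  constructor <;> linarith [h1.1, h1.2]

/-- Poisson equation: splitting off the first summand of the series leaves the same series after one
step of `π`. -/
theorem Model.Mixing.bias_eq {M : Model S A L} {τ : ℝ} (hτ : 0 < τ)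
    (hM : M.Mixing τ) (π : Policy S A) {l : S → A → ℝ} (hl : ∀ s a, |l s a| ≤ 1) (s : S) :
    M.bias π l s = policyLoss π l s - M.avgLoss l π + M.backup π (M.bias π l) s := by
  have hs : HasSum (fun n => M.backup π (M.excess π l n) s) (M.backup π (M.bias π l) s) :=
    hasSum_sum fun a _ => (hasSum_sum fun s' _ =>
      (hM.summable_excess hτ π hl s').hasSum.mul_left _).mul_left _
  unfold Model.bias at hs ⊢
  rw [(hM.summable_excess hτ π hl s).tsum_eq_zero_add, ← hs.tsum_eq]
  congr 1
  refine tsum_congr fun n => ?_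
  simp only [Model.excess, Function.iterate_succ_apply', Model.backup, mul_sub,
    Finset.sum_sub_distrib, ← Finset.sum_mul, stdSimplex.sum_eq_one, one_mul]

/-- The performance difference identity. -/
theorem Model.Mixing.avgLoss_sub_avgLoss {M : Model S A L} {τ : ℝ} (hτ : 0 < τ)
    (hM : M.Mixing τ) (p π : Policy S A) {l : S → A → ℝ} (hl : ∀ s a, |l s a| ≤ 1) :
    M.avgLoss l p - M.avgLoss l π =
      ∑ s, M.stationary π s * ∑ a, (p s a - π s a) * M.Q p l s a := by
  have h1 : ∀ q : Policy S A, ∀ s, ∑ a, q s a * M.Q p l s a =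
      policyLoss q l s - M.avgLoss l p + M.backup q (M.bias p l) s := fun q s => by
    simp only [hM.Q_eq hτ p hl, mul_add, mul_sub, Finset.sum_add_distrib, Finset.sum_sub_distrib,
      ← Finset.sum_mul, stdSimplex.sum_eq_one, one_mul, policyLoss, Model.backup]
  -- Averaged over the stationary law of `π`, the bias of `p` and its backup under `π` agree, so
  -- they cancel and only the average losses remain.
  have h2 := M.sum_step_mul π (M.stationary π) (M.bias p l)
  rw [hM.step_stationary hτ π] at h2
  simp only [sub_mul, Finset.sum_sub_distrib, mul_sub, h1, ← hM.bias_eq hτ p hl, mul_add,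
    Finset.sum_add_distrib, ← h2, ← M.avgLoss_eq, ← Finset.sum_mul, stdSimplex.sum_eq_one, one_mul]
  ring

/-! ### Multiplicative weights with signed feedback -/

theorem sum_mul_exp_pos (w : stdSimplex ℝ A) (f : A → ℝ) : 0 < ∑ a, w a * Real.exp (f a) := by
  have h0 : ∀ a ∈ Finset.univ, 0 ≤ w a * Real.exp (f a) :=
    fun a _ => mul_nonneg (stdSimplex.zero_le w a) (Real.exp_pos _).le
  refine lt_of_le_of_ne (Finset.sum_nonneg h0) fun h => ?_
  have h1 : ∑ a, w a = 0 := Finset.sum_eq_zero fun a ha =>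
    (mul_eq_zero.1 ((Finset.sum_eq_zero_iff_of_nonneg h0).1 h.symm a ha)).resolve_right
      (Real.exp_pos _).ne'
  rw [stdSimplex.sum_eq_one] at h1
  exact one_ne_zero h1

theorem mwuStep_apply (μ : ℝ) (w : stdSimplex ℝ A) (k : A → ℝ) (a : A) :
    mwuStep μ w k a = w a * Real.exp (-μ * k a) / ∑ b, w b * Real.exp (-μ * k b) := rfl

theorem mwuStep_pos {μ : ℝ} {w : stdSimplex ℝ A} {k : A → ℝ} {a : A} (hw : 0 < w a) :
    0 < mwuStep μ w k a :=
  div_pos (mul_pos hw (Real.exp_pos _)) (sum_mul_exp_pos w _)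

/-- Every weight is multiplied by at least `exp (-2μB) ≥ 1 - 2μB`. As both weight vectors have total
mass one, the `ℓ₁` distance is twice the mass lost, hence at most `4μB`. No smallness of `μB` is
needed. -/
theorem l1dist_mwuStep_le {μ B : ℝ} (hμ : 0 ≤ μ) (w : stdSimplex ℝ A) {k : A → ℝ}
    (hk : ∀ a, |k a| ≤ B) : l1dist w (mwuStep μ w k) ≤ 4 * μ * B := by
  have hZ := sum_mul_exp_pos w fun a => -μ * k a
  have hZle : ∑ b, w b * Real.exp (-μ * k b) ≤ Real.exp (μ * B) := by
    calc ∑ b, w b * Real.exp (-μ * k b) ≤ ∑ b, w b * Real.exp (μ * B) :=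
          Finset.sum_le_sum fun b _ => mul_le_mul_of_nonneg_left (Real.exp_le_exp.2 (by
            nlinarith [(abs_le.1 (hk b)).1])) (stdSimplex.zero_le w b)
      _ = Real.exp (μ * B) := by rw [← Finset.sum_mul, stdSimplex.sum_eq_one, one_mul]
  have hlow : ∀ a, w a * (1 - 2 * μ * B) ≤ mwuStep μ w k a := fun a => by
    rw [mwuStep_apply, mul_div_assoc]
    refine mul_le_mul_of_nonneg_left ?_ (stdSimplex.zero_le w a)
    rw [le_div_iff₀ hZ]
    have h1 : 1 - 2 * μ * B ≤ Real.exp (-(2 * μ * B)) := by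
      linarith [Real.add_one_le_exp (-(2 * μ * B))]
    calc (1 - 2 * μ * B) * ∑ b, w b * Real.exp (-μ * k b)
        ≤ Real.exp (-(2 * μ * B)) * Real.exp (μ * B) :=
          mul_le_mul h1 hZle hZ.le (Real.exp_pos _).le
      _ ≤ Real.exp (-μ * k a) := by
          rw [← Real.exp_add, Real.exp_le_exp]
          nlinarith [(abs_le.1 (hk a)).2]
  by_cases hA : Nonempty A
  · have hB : 0 ≤ B := (abs_nonneg _).trans (hk hA.some)
    have h2 : ∀ a, |w a - mwuStep μ w k a| ≤
        4 * μ * B * w a - (w a - mwuStep μ w k a) := fun a => by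
      have h3 : 0 ≤ μ * B * w a := mul_nonneg (mul_nonneg hμ hB) (stdSimplex.zero_le w a)
      rw [abs_le]
      constructor <;> nlinarith [hlow a]
    refine (Finset.sum_le_sum fun a _ => h2 a).trans (le_of_eq ?_)
    rw [Finset.sum_sub_distrib, ← Finset.mul_sum, Finset.sum_sub_distrib]
    simp only [stdSimplex.sum_eq_one]
    ring
  · have := stdSimplex.sum_eq_one w
    simp [not_nonempty_iff.1 hA] at this

/-- The log-ratio of new to old weights is `-μ k - log Z`. Averaging it over the new weights gives a
relative entropy, which is nonnegative and so bounds `log Z`; averaging over `q` then gives the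
claim. The right side telescopes over rounds. -/
theorem sum_mwuStep_mul_le {μ : ℝ} {w : stdSimplex ℝ A} (hw : ∀ a, 0 < w a) (k : A → ℝ)
    (q : stdSimplex ℝ A) :
    μ * ∑ a, (mwuStep μ w k a - q a) * k a ≤
      ∑ a, q a * (Real.log (mwuStep μ w k a) - Real.log (w a)) := by
  set Z := ∑ b, w b * Real.exp (-μ * k b) with hZdef
  have hZ : 0 < Z := sum_mul_exp_pos w _
  have hlog : ∀ a, Real.log (mwuStep μ w k a) - Real.log (w a) = -μ * k a - Real.log Z :=
    fun a => by
      rw [mwuStep_apply, Real.log_div (mul_pos (hw a) (Real.exp_pos _)).ne' hZ.ne',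
        Real.log_mul (hw a).ne' (Real.exp_pos _).ne', Real.log_exp]
      ring
  have hsum : ∀ r : stdSimplex ℝ A,
      ∑ a, r a * (Real.log (mwuStep μ w k a) - Real.log (w a)) =
        -μ * ∑ a, r a * k a - Real.log Z := fun r => by
    simp only [hlog, mul_sub, Finset.sum_sub_distrib, ← Finset.sum_mul, stdSimplex.sum_eq_one,
      one_mul, Finset.mul_sum]
    congr 1
    exact Finset.sum_congr rfl fun _ _ => by ring
  have hkl : 0 ≤ ∑ a, mwuStep μ w k a * (Real.log (mwuStep μ w k a) - Real.log (w a)) := by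
    have h1 : ∀ a, mwuStep μ w k a - w a ≤
        mwuStep μ w k a * (Real.log (mwuStep μ w k a) - Real.log (w a)) := fun a => by
      have hp := mwuStep_pos (μ := μ) (k := k) (hw a)
      have h2 := Real.log_le_sub_one_of_pos (div_pos (hw a) hp)
      rw [Real.log_div (hw a).ne' hp.ne'] at h2
      have h3 := mul_le_mul_of_nonneg_left h2 hp.le
      rw [mul_sub (mwuStep μ w k a) (w a / _), mul_div_cancel₀ _ hp.ne'] at h3
      linarith
    have h4 := Finset.sum_le_sum fun a (_ : a ∈ Finset.univ) => h1 a
    rw [Finset.sum_sub_distrib, stdSimplex.sum_eq_one, stdSimplex.sum_eq_one, sub_self] at h4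
    exact h4
  rw [hsum] at hkl ⊢
  simp only [sub_mul, Finset.sum_sub_distrib]
  linarith

/-- The regret bound of multiplicative weights with feedback in `[-B, B]`. -/
theorem mwu_regret_le [Nonempty A] {μ B : ℝ} (hμ : 0 < μ) (w : ℕ → stdSimplex ℝ A)
    (k : ℕ → A → ℝ) (h0 : w 0 = uniform) (hstep : ∀ t, w (t + 1) = mwuStep μ (w t) (k t))
    (hk : ∀ t a, |k t a| ≤ B) (q : stdSimplex ℝ A) (T : ℕ) :
    ∑ t ∈ Finset.range T, ∑ a, (w t a - q a) * k t a ≤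
      Real.log (Fintype.card A) / μ + T * (4 * μ * B ^ 2) := by
  have hpos : ∀ t a, 0 < w t a := fun t => by
    induction t with
    | zero =>
      intro a
      rw [h0]
      change 0 < 1 / (Fintype.card A : ℝ)
      have : 0 < Fintype.card A := Fintype.card_pos
      positivity
    | succ t ih =>
      intro a
      rw [hstep]
      exact mwuStep_pos (ih a)
  have hB : 0 ≤ B := (abs_nonneg _).trans (hk 0 (Classical.arbitrary A))
  -- The telescoping bound concerns the look-ahead weights `w (t + 1)`; replacing them by `w t`
  -- costs `B` times the step length `4μB`.
  have hround : ∀ t, ∑ a, (w t a - q a) * k t a ≤ 4 * μ * B ^ 2 +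
      (∑ a, q a * Real.log (w (t + 1) a) - ∑ a, q a * Real.log (w t a)) / μ := fun t => by
    have h1 := sum_mwuStep_mul_le (μ := μ) (hpos t) (k t) q
    have h2 := (abs_le.1 (abs_sum_sub_sum_le_l1dist (w t) (w (t + 1)) (hk t))).2
    have h3 := l1dist_mwuStep_le hμ.le (w t) (hk t)
    rw [← hstep] at h1 h3
    have h4 : ∑ a, (w (t + 1) a - q a) * k t a ≤
        (∑ a, q a * Real.log (w (t + 1) a) - ∑ a, q a * Real.log (w t a)) / μ := by
      rw [le_div_iff₀ hμ, mul_comm, ← Finset.sum_sub_distrib]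
      simpa only [mul_sub] using h1
    have h5 := mul_le_mul_of_nonneg_left h3 hB
    simp only [sub_mul, Finset.sum_sub_distrib] at h4 ⊢
    nlinarith
  refine (Finset.sum_le_sum fun t _ => hround t).trans ?_
  rw [Finset.sum_add_distrib, ← Finset.sum_div, Finset.sum_range_sub
    (fun t => ∑ a, q a * Real.log (w t a)), Finset.sum_const, Finset.card_range, nsmul_eq_mul,
    add_comm]
  gcongr
  have h6 : ∑ a, q a * Real.log (w T a) ≤ 0 := Finset.sum_nonpos fun a _ =>
    mul_nonpos_of_nonneg_of_nonpos (stdSimplex.zero_le q a)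
      (Real.log_nonpos (stdSimplex.zero_le _ a) (stdSimplex.le_one _ a))
  have h7 : ∑ a, q a * Real.log (w 0 a) = -Real.log (Fintype.card A) := by
    rw [h0]
    change ∑ a, q a * Real.log (1 / (Fintype.card A : ℝ)) = _
    rw [← Finset.sum_mul, stdSimplex.sum_eq_one, one_mul, one_div, Real.log_inv]
  linarith

/-! ### The distance from the stationary distributions -/

theorem Model.l1dist_step_step_le (M : Model S A L) {p q : Policy S A} {δ : ℝ}
    (h : ∀ s, l1dist (p s) (q s) ≤ δ) (d : stdSimplex ℝ S) :
    l1dist (M.step p d) (M.step q d) ≤ δ := by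
  have h1 : ∀ y, |M.step p d y - M.step q d y| ≤
      ∑ s, ∑ a, d s * |p s a - q s a| * M.trans s a y := fun y => by
    change |∑ s, d s * ∑ a, p s a * M.trans s a y - ∑ s, d s * ∑ a, q s a * M.trans s a y| ≤ _
    rw [← Finset.sum_sub_distrib]
    refine (Finset.abs_sum_le_sum_abs _ _).trans (Finset.sum_le_sum fun s _ => ?_)
    rw [← mul_sub, ← Finset.sum_sub_distrib, Finset.mul_sum]
    refine (Finset.abs_sum_le_sum_abs _ _).trans (Finset.sum_le_sum fun a _ => ?_)
    rw [← sub_mul, abs_mul, abs_mul, abs_of_nonneg (stdSimplex.zero_le d s),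
      abs_of_nonneg (stdSimplex.zero_le (M.trans s a) y), mul_assoc]
  calc l1dist (M.step p d) (M.step q d)
      ≤ ∑ y, ∑ s, ∑ a, d s * |p s a - q s a| * M.trans s a y :=
        Finset.sum_le_sum fun y _ => h1 y
    _ = ∑ s, d s * l1dist (p s) (q s) := by
        rw [Finset.sum_comm]
        refine Finset.sum_congr rfl fun s _ => ?_
        rw [Finset.sum_comm, l1dist, Finset.mul_sum]
        exact Finset.sum_congr rfl fun a _ => by
          rw [← Finset.mul_sum, stdSimplex.sum_eq_one, mul_one]
    _ ≤ ∑ s, d s * δ := Finset.sum_le_sum fun s _ =>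
        mul_le_mul_of_nonneg_left (h s) (stdSimplex.zero_le d s)
    _ = δ := by rw [← Finset.sum_mul, stdSimplex.sum_eq_one, one_mul]

/-- With `x` the distance and `c` the contraction factor, stationarity and one step of each policy
give `x ≤ δ + c x`. -/
theorem Model.Mixing.l1dist_stationary_le {M : Model S A L} {τ : ℝ} (hτ : 0 < τ)
    (hM : M.Mixing τ) {p q : Policy S A} {δ : ℝ} (h : ∀ s, l1dist (p s) (q s) ≤ δ) :
    l1dist (M.stationary p) (M.stationary q) ≤ δ * (1 - Real.exp (-1 / τ))⁻¹ := by
  have h1 := M.l1dist_step_step_le h (M.stationary p)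
  have h2 := hM.l1dist_step_le q (M.stationary p) (M.stationary q)
  have h3 := l1dist_triangle (M.step p (M.stationary p)) (M.step q (M.stationary p))
    (M.step q (M.stationary q))
  rw [hM.step_stationary hτ p] at h1 h3
  rw [hM.step_stationary hτ q] at h2 h3
  rw [← div_eq_mul_inv, le_div_iff₀ (by linarith [exp_neg_one_div_lt_one hτ])]
  linarith

theorem Model.Mixing.sum_l1dist_stateLaw_le {M : Model S A L} {τ : ℝ} (hτ : 0 < τ)
    (hM : M.Mixing τ) (d : stdSimplex ℝ S) {p : ℕ → Policy S A} {δ : ℝ}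
    (h : ∀ t s, l1dist (p t s) (p (t + 1) s) ≤ δ) (T : ℕ) :
    ∑ t ∈ Finset.range T, l1dist (M.stateLaw d p t) (M.stationary (p t)) ≤
      2 * (1 - Real.exp (-1 / τ))⁻¹ + T * δ * (1 - Real.exp (-1 / τ))⁻¹ ^ 2 := by
  set c := Real.exp (-1 / τ) with hc
  have hc1 : 0 < 1 - c := by linarith [exp_neg_one_div_lt_one hτ]
  set K := (1 - c)⁻¹ with hK
  have hKpos : 0 < K := inv_pos.2 hc1
  have hKc : K * (1 - c) = 1 := inv_mul_cancel₀ hc1.ne'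
  have hδ : 0 ≤ δ * K := (l1dist_nonneg _ _).trans (hM.l1dist_stationary_le hτ (h 0))
  set x : ℕ → ℝ := fun t => l1dist (M.stateLaw d p t) (M.stationary (p t)) with hx
  have hrec : ∀ t, x (t + 1) ≤ c * x t + δ * K := fun t => by
    have h1 := hM.l1dist_step_le (p t) (M.stateLaw d p t) (M.stationary (p t))
    rw [hM.step_stationary hτ] at h1
    exact (l1dist_triangle _ (M.stationary (p t)) _).trans
      (add_le_add h1 (hM.l1dist_stationary_le hτ (h t)))
  -- `K * x n` is a potential: since `K - K c = 1`, its decrease under the recursion pays for the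
  -- next summand `x n`, up to `δK²`.
  have hsum : ∀ n : ℕ, ∑ t ∈ Finset.range n, x t + K * x n ≤ 2 * K + n * (δ * K ^ 2) := by
    intro n
    induction n with
    | zero =>
      simp only [Finset.range_zero, Finset.sum_empty, Nat.cast_zero]
      nlinarith [l1dist_le_two (M.stateLaw d p 0) (M.stationary (p 0))]
    | succ n ih =>
      rw [Finset.sum_range_succ]
      push_cast
      have h2 := mul_le_mul_of_nonneg_left (hrec n) hKpos.le
      have h3 : K * x n - K * (c * x n) = x n := by linear_combination x n * hKc
      nlinarith
  have h4 := hsum T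
  have h5 : 0 ≤ K * x T := mul_nonneg hKpos.le (l1dist_nonneg _ _)
  nlinarith

theorem Adversary.abs_cumLoss_sub_le {M : Model S A L} {τ : ℝ} (hτ : 0 < τ)
    (hM : M.Mixing τ) (adv : Adversary M) {p : ℕ → Policy S A} {δ : ℝ}
    (hl : ∀ t s a, |adv.lossAt p t s a| ≤ 1)
    (h : ∀ t s, l1dist (p t s) (p (t + 1) s) ≤ δ) (T : ℕ) :
    |adv.cumLoss p T - ∑ t ∈ Finset.range T, M.avgLoss (adv.lossAt p t) (p t)| ≤
      2 * (1 - Real.exp (-1 / τ))⁻¹ + T * δ * (1 - Real.exp (-1 / τ))⁻¹ ^ 2 := by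
  refine le_trans ?_ (hM.sum_l1dist_stateLaw_le hτ M.init h T)
  rw [adv.cumLoss_eq, ← Finset.sum_sub_distrib]
  refine (Finset.abs_sum_le_sum_abs _ _).trans (Finset.sum_le_sum fun t _ => ?_)
  have h1 := abs_sum_sub_sum_le_l1dist (M.stateLaw M.init p t) (M.stationary (p t))
    (abs_policyLoss_le (hl t) (p t))
  rw [← M.avgLoss_eq, one_mul] at h1
  have h2 : ∑ s, ∑ a, adv.lossAt p t s a * (M.stateLaw M.init p t s * p t s a) =
      ∑ s, M.stateLaw M.init p t s * policyLoss (p t) (adv.lossAt p t) s := by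
    simp only [policyLoss, Finset.mul_sum]
    exact Finset.sum_congr rfl fun _ _ => Finset.sum_congr rfl fun _ _ => by ring
  rwa [h2]

/-! ### The strategic adversary and the four-term decomposition -/

theorem Adversary.lossAt_mem_Icc {M : Model S A L} (adv : Adversary M) (p : ℕ → Policy S A)
    (t : ℕ) (s : S) (a : A) : adv.lossAt p t s a ∈ Set.Icc (0 : ℝ) 1 := by
  obtain ⟨x, hx, h⟩ := (adv t fun i => p i).2
  have h' : adv.lossAt p t s a = ∑ i, x i * M.loss i s a := h s a
  rw [h']
  refine ⟨Finset.sum_nonneg fun i _ => mul_nonneg (hx.1 i) (M.loss_mem i s a).1, ?_⟩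
  calc ∑ i, x i * M.loss i s a ≤ ∑ i, x i * 1 :=
        Finset.sum_le_sum fun i _ => mul_le_mul_of_nonneg_left (M.loss_mem i s a).2 (hx.1 i)
    _ = 1 := by simpa using hx.2

/-- Against a fixed policy, a strategic adversary does almost as well as with any fixed
sequence of losses from `Δ_L`. -/
theorem Adversary.Strategic.sum_avgLoss_sub_le {M : Model S A L} {adv : Adversary M} {T : ℕ}
    (h : adv.Strategic T) (hT : 1 ≤ T) (p : ℕ → Policy S A) (π : Policy S A) :
    ∑ t ∈ Finset.range T, M.avgLoss (adv.lossAt p t) π -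
      ∑ t ∈ Finset.range T, M.avgLoss (adv.lossAt (fun _ => π) t) π ≤ √(T * Real.log L / 2) := by
  -- Each loss `adv.lossAt p i` serves as a fixed comparator against constant play of `π`. Summing
  -- the `T` inequalities puts a factor `T` on both sides, which is then cancelled.
  have h1 := Finset.sum_le_sum fun i (_ : i ∈ Finset.range T) =>
    h (fun _ => π) (adv.lossAt p i) (adv i fun j => p j).2
  simp only [Finset.sum_const, Finset.card_range, nsmul_eq_mul, Finset.sum_sub_distrib,
    ← Finset.mul_sum] at h1
  have hT' : (0 : ℝ) < T := by exact_mod_cast hT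
  rw [← mul_sub] at h1
  exact le_of_mul_le_mul_left h1 hT'

theorem mdpExpert_succ [Nonempty A] {M : Model S A L} (adv : Adversary M) (μ : ℕ → ℝ) (t : ℕ)
    (s : S) :
    mdpExpert adv μ (t + 1) s = mwuStep (μ t) (mdpExpert adv μ t s)
      (M.Q (mdpExpert adv μ t) (adv.lossAt (mdpExpert adv μ) t) s) := by
  rw [mdpExpert]
  rfl

theorem mdpExpert_zero [Nonempty A] {M : Model S A L} (adv : Adversary M) (μ : ℕ → ℝ) (s : S) :
    mdpExpert adv μ 0 s = uniform := by
  rw [mdpExpert]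

theorem Adversary.sum_avgLoss_mdpExpert_sub_le [Nonempty A] {M : Model S A L} {τ : ℝ} (hτ : 0 < τ)
    (hM : M.Mixing τ) (adv : Adversary M) {μ : ℝ} (hμ : 0 < μ) (π : Policy S A) (T : ℕ) :
    ∑ t ∈ Finset.range T, M.avgLoss (adv.lossAt (mdpExpert adv fun _ => μ) t)
        (mdpExpert adv (fun _ => μ) t) -
      ∑ t ∈ Finset.range T, M.avgLoss (adv.lossAt (mdpExpert adv fun _ => μ) t) π ≤
    Real.log (Fintype.card A) / μ + T * (4 * μ * (4 * (1 - Real.exp (-1 / τ))⁻¹) ^ 2) := by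
  set p := mdpExpert adv fun _ => μ with hp
  have hl : ∀ t s a, |adv.lossAt p t s a| ≤ 1 := fun t s a => by
    have h := adv.lossAt_mem_Icc p t s a
    exact abs_le.2 ⟨by linarith [h.1], h.2⟩
  rw [← Finset.sum_sub_distrib]
  simp only [hM.avgLoss_sub_avgLoss hτ _ π (hl _)]
  rw [Finset.sum_comm]
  simp only [← Finset.mul_sum]
  calc ∑ s, M.stationary π s * ∑ t ∈ Finset.range T, ∑ a,
        (p t s a - π s a) * M.Q (p t) (adv.lossAt p t) s a
      ≤ ∑ s, M.stationary π s * (Real.log (Fintype.card A) / μ +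
          T * (4 * μ * (4 * (1 - Real.exp (-1 / τ))⁻¹) ^ 2)) :=
        Finset.sum_le_sum fun s _ => mul_le_mul_of_nonneg_left
          (mwu_regret_le hμ (fun t => p t s) (fun t => M.Q (p t) (adv.lossAt p t) s)
            (mdpExpert_zero adv _ s) (fun t => mdpExpert_succ adv _ t s)
            (fun t => hM.abs_Q_le hτ _ (adv.lossAt_mem_Icc p t) s) (π s) T)
          (stdSimplex.zero_le _ s)
    _ = _ := by rw [← Finset.sum_mul, stdSimplex.sum_eq_one, one_mul]

theorem Adversary.policyRegret_mdpExpert_le [Nonempty A] {M : Model S A L} {τ : ℝ} (hτ : 0 < τ)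
    (hM : M.Mixing τ) {adv : Adversary M} {T : ℕ} (hT : 1 ≤ T) (hadv : adv.Strategic T)
    {μ K : ℝ} (hμ : 0 < μ) (hK : K = (1 - Real.exp (-1 / τ))⁻¹) (π : Policy S A) :
    adv.policyRegret (mdpExpert adv fun _ => μ) π T ≤
      √(T * Real.log L / 2) + Real.log (Fintype.card A) / μ + 4 * K + 64 * T * μ * K ^ 2 +
        16 * T * μ * K ^ 3 := by
  have hl : ∀ p t s a, |adv.lossAt p t s a| ≤ 1 := fun p t s a => by
    have h := adv.lossAt_mem_Icc p t s a
    exact abs_le.2 ⟨by linarith [h.1], h.2⟩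
  have h1 := (abs_le.1 (adv.abs_cumLoss_sub_le hτ hM (hl (mdpExpert adv fun _ => μ))
    (δ := 4 * μ * (4 * K)) (fun t s => by
      rw [mdpExpert_succ, hK]
      exact l1dist_mwuStep_le hμ.le _
        (hM.abs_Q_le hτ _ (adv.lossAt_mem_Icc _ t) s)) T)).2
  have h2 := adv.sum_avgLoss_mdpExpert_sub_le hτ hM hμ π T
  have h3 := hadv.sum_avgLoss_sub_le hT (mdpExpert adv fun _ => μ) π
  have h4 := (abs_le.1 (adv.abs_cumLoss_sub_le hτ hM (hl fun _ => π) (δ := 0)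
    (fun _ s => by simp [l1dist]) T)).1
  rw [← hK] at h1 h2 h4
  unfold Adversary.policyRegret
  linear_combination h1 + h2 + h3 + h4

/-- With a single action the prescribed learning rate is zero, so the general bound, which divides
by it, is unavailable. -/
theorem Adversary.policyRegret_of_subsingleton [Subsingleton A] {M : Model S A L}
    (adv : Adversary M) (p : ℕ → Policy S A) (π : Policy S A) (T : ℕ) :
    adv.policyRegret p π T = 0 := by
  have h : p = fun _ => π := Subsingleton.elim _ _
  rw [h, Adversary.policyRegret, sub_self]

theorem inv_one_sub_exp_le {τ : ℝ} (hτ : 0 < τ) : (1 - Real.exp (-1 / τ))⁻¹ ≤ 1 + τ := by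
  have h1 := Real.add_one_le_exp (1 / τ)
  have h2 : Real.exp (-1 / τ) ≤ (1 / τ + 1)⁻¹ := by
    rw [neg_div, Real.exp_neg]
    exact inv_anti₀ (by positivity) h1
  have h3 : (1 + τ)⁻¹ ≤ 1 - Real.exp (-1 / τ) := by
    have : (1 / τ + 1)⁻¹ = 1 - (1 + τ)⁻¹ := by field_simp; ring
    linarith
  exact (inv_anti₀ (by positivity) h3).trans (by rw [inv_inv])

end OMDP

end

/-! ### Choice of the constants -/

theorem mainTheorem1 :
    ∀ τ₀ : ℝ, 0 < τ₀ → ∃ C : ℝ, 0 < C ∧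
      ∀ (S A : Type*) [Fintype S] [Fintype A] [Nonempty A] (L : ℕ)
        (M : OMDP.Model S A L) (adv : OMDP.Adversary M) (τ : ℝ) (T : ℕ),
        τ₀ ≤ τ → 1 ≤ T → M.Mixing τ → adv.Strategic T →
        ∀ π : OMDP.Policy S A,
          adv.policyRegret
              (OMDP.mdpExpert adv fun _ => √(8 * Real.log (Fintype.card A) / T) / (3 * τ)) π T
            ≤ C * (√(T * Real.log L) + τ ^ 2 * √(T * Real.log (Fintype.card A))) := by
  intro τ₀ hτ₀
  set κ : ℝ := 1 + 1 / τ₀ with hκ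
  have hκpos : 0 < κ := by positivity
  -- `16κ³` comes from the drift term, already of order `τ²`. The coefficients `3`, `64κ²` and `8κ`
  -- belong to terms of order `τ`, raised to `τ²` through `τ ≤ τ²/τ₀`. The leading `1` covers `√(T
  -- log L)`.
  refine ⟨1 + 16 * κ ^ 3 + (3 + 64 * κ ^ 2 + 8 * κ) / τ₀, by positivity, ?_⟩
  intro S A _ _ _ L M adv τ T hτle hT hM hadv π
  have hτ : 0 < τ := hτ₀.trans_le hτle
  rcases subsingleton_or_nontrivial A with hA | hA
  · rw [adv.policyRegret_of_subsingleton]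
    positivity
  have hT' : (1 : ℝ) ≤ T := by exact_mod_cast hT
  set a := Real.log (Fintype.card A) with ha
  have ha2 : 1 / 2 ≤ a := by
    have h1 : (2 : ℝ) ≤ Fintype.card A := by exact_mod_cast Fintype.one_lt_card
    have h2 := Real.log_le_log (by norm_num) h1
    linarith [Real.log_two_gt_d9]
  set R := √(T * a) with hR
  have hRsq : R ^ 2 = T * a := Real.sq_sqrt (by positivity)
  -- This lower bound lets the mixing cost `4K`, which does not grow with `T`, be absorbed into a
  -- multiple of `τ R`.
  have hR0 : 1 / 2 ≤ R := Real.le_sqrt_of_sq_le (by nlinarith)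
  set m := √(8 * a / T) with hm
  have hmpos : 0 < m := Real.sqrt_pos.2 (by positivity)
  have hTm : T * m ≤ 3 * R := by
    have h1 : T * m = √8 * R := by
      rw [hm, hR, ← Real.sqrt_mul (by norm_num), ← Real.sqrt_sq (show (0 : ℝ) ≤ T by linarith),
        ← Real.sqrt_mul (by positivity), Real.sqrt_sq (show (0 : ℝ) ≤ T by linarith)]
      congr 1
      field_simp
    have h2 : √8 ≤ 3 := Real.sqrt_le_iff.2 (by norm_num)
    rw [h1]
    gcongr
  have ham : a / m ≤ R := by
    rw [div_le_iff₀ hmpos, hR, hm, ← Real.sqrt_mul (by positivity)]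
    refine Real.le_sqrt_of_sq_le ?_
    have : T * a * (8 * a / T) = 8 * a ^ 2 := by field_simp
    nlinarith [sq_nonneg a]
  set K := (1 - Real.exp (-1 / τ))⁻¹ with hK
  have hKpos : 0 < K := inv_pos.2 (by linarith [OMDP.exp_neg_one_div_lt_one hτ])
  have hKle : K ≤ κ * τ := by
    have h1 := OMDP.inv_one_sub_exp_le hτ
    have h2 : 1 ≤ τ / τ₀ := (one_le_div hτ₀).2 hτle
    have h3 : κ * τ = τ + τ / τ₀ := by rw [hκ]; ring
    linarith
  have hmain := OMDP.Adversary.policyRegret_mdpExpert_le hτ hM hT hadv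
    (μ := m / (3 * τ)) (by positivity) hK π
  have hτsq : τ * R ≤ τ ^ 2 * R / τ₀ := by
    rw [le_div_iff₀ hτ₀]
    have : 0 ≤ τ * R := by positivity
    nlinarith
  have e0 : √(T * Real.log L / 2) ≤ √(T * Real.log L) :=
    Real.sqrt_le_sqrt (half_le_self (by positivity))
  have e1 : a / (m / (3 * τ)) ≤ 3 * (τ * R) := by
    have : a / (m / (3 * τ)) = 3 * τ * (a / m) := by field_simp
    rw [this]
    nlinarith
  have e2 : 4 * K ≤ 8 * κ * (τ * R) := by
    have : κ * τ * 1 ≤ κ * τ * (2 * R) := by gcongr; linarith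
    linarith
  have e3 : 64 * T * (m / (3 * τ)) * K ^ 2 ≤ 64 * κ ^ 2 * (τ * R) := by
    calc 64 * T * (m / (3 * τ)) * K ^ 2 = 64 * (T * m) / (3 * τ) * K ^ 2 := by ring
      _ ≤ 64 * (3 * R) / (3 * τ) * (κ * τ) ^ 2 := by gcongr
      _ = 64 * κ ^ 2 * (τ * R) := by field_simp
  have e4 : 16 * T * (m / (3 * τ)) * K ^ 3 ≤ 16 * κ ^ 3 * (τ ^ 2 * R) := by
    calc 16 * T * (m / (3 * τ)) * K ^ 3 = 16 * (T * m) / (3 * τ) * K ^ 3 := by ring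
      _ ≤ 16 * (3 * R) / (3 * τ) * (κ * τ) ^ 3 := by gcongr
      _ = 16 * κ ^ 3 * (τ ^ 2 * R) := by field_simp
  have e5 : (3 + 64 * κ ^ 2 + 8 * κ) * (τ * R) ≤ (3 + 64 * κ ^ 2 + 8 * κ) * (τ ^ 2 * R / τ₀) := by
    gcongr
  have e6 : 0 ≤ (16 * κ ^ 3 + (3 + 64 * κ ^ 2 + 8 * κ) / τ₀) * √(T * Real.log L) := by positivity
  have e7 : 0 ≤ τ ^ 2 * R := by positivity
  linear_combination hmain + e0 + e1 + e2 + e3 + e4 + e5 + e6 + e7
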